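/- **Conventions.** For a finite group $G$ and $S\subseteq G$ put $Q(S)=\{s_1s_2^{-1}:s_1,s_2\in S\}$. Subsets $S_1,S_2,S_3\subseteq G$ satisfy the *triple product property* if for $q_i\in Q(S_i)$ the equation $q_1q_2q_3=1$ implies $q_1=q_2=q_3=1$; if moreover $|S_1|=a$, $|S_2|=b$, $|S_3|=c$, then $G$ *realizes* $\langle a,b,c\rangle$. The *pseudo-exponent* $\alpha(G)$ of a non-trivial finite group $G$ is the minimum of $3\log|G|/\log(abc)$ over all positive integers $a,b,c$, not all $1$, such that $G$ realizes $\langle a,b,c\rangle$ (and $\alpha(G)=3$ if $G$ is trivial). The character degrees of $G$ are the dimensions of its irreducible complex representations. If $G$ is not abelian, $\gamma(G)$ is the real number such that $|G|^{1/\gamma(G)}$ is the largest character degree of $G$; if $G$ is abelian, $\gamma(G)=\infty$. For $n\ge 1$ let $A=\mathbb{Z}/2n\mathbb{Z}$ and let $G_n=A\wr S_n=S_n\ltimes A^n$, with multiplication $(\pi,x)(\pi',y)=(\pi\pi',\pi'x+y)$, where $(\pi x)_i=x_{\pi(i)}$. Let $u=(1,2,\dots,n)$ and $v=(n,n-1,\dots,1)$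 in $A^n$. **Theorem.** For every $n\ge 1$: 1. the sets $H_1=\{(\pi,0):\pi\in S_n\}$, $H_2=\{(\pi,\pi u-u):\pi\in S_n\}$ and $H_3=\{(\pi,\pi v-v):\pi\in S_n\}$ are subgroups of $G_n$ and satisfy the triple product property; 2. the largest character degree of $G_n$ is $n!$; 3. $\alpha(G_n)\le\gamma(G_n)$. Moreover there is a constant $C$ such that for all $n\ge 2$ the number $\gamma(G_n)$ is finite and $$\left|\gamma(G_n)-\left(2+\frac{1+\log 2}{\log n}\right)\right|\le\frac{C}{(\log n)^2},$$ that is, $\gamma(G_n)=2+\frac{1+\log 2}{\log n}+O\!\left(\frac{1}{(\log n)^2}\right)$. -/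

import Mathlib

open scoped Nat

noncomputable section

/-- The right quotient set `Q(S) = {s₁ s₂⁻¹ : s₁, s₂ ∈ S}`. -/
def rightQuotientSet {G : Type*} [Group G] (S : Set G) : Set G :=
  {q | ∃ s₁ ∈ S, ∃ s₂ ∈ S, q = s₁ * s₂⁻¹}

/-- The triple product property of three subsets of a group. -/
def TripleProductProperty {G : Type*} [Group G] (S₁ S₂ S₃ : Set G) : Prop :=
  ∀ q₁ ∈ rightQuotientSet S₁, ∀ q₂ ∈ rightQuotientSet S₂, ∀ q₃ ∈ rightQuotientSet S₃,
    q₁ * q₂ * q₃ = 1 → q₁ = 1 ∧ q₂ = 1 ∧ q₃ = 1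

/-- The group `G` realizes `⟨n, m, p⟩`. -/
def Realizes (G : Type*) [Group G] (n m p : ℕ) : Prop :=
  ∃ S₁ S₂ S₃ : Finset G, S₁.card = n ∧ S₂.card = m ∧ S₃.card = p ∧
    TripleProductProperty (S₁ : Set G) (S₂ : Set G) (S₃ : Set G)

/-- The values `3 log |G| / log (nmp)`, where `n, m, p` are positive integers, not all equal to `1`
(together this says `1 < n * m * p`), such that `G` realizes `⟨n, m, p⟩`. -/
def pseudoExponentValues (G : Type*) [Group G] : Set ℝ :=
  {x | ∃ n m p : ℕ, 1 < n * m * p ∧ Realizes G n m p ∧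
    x = 3 * Real.log (Nat.card G) / Real.log ((n * m * p : ℕ) : ℝ)}

open Classical in
/-- The pseudo-exponent `α(G)` of a finite group. The infimum is a minimum for a non-trivial finite
group, see `isLeast_pseudoExponent`. -/
def pseudoExponent (G : Type*) [Group G] : ℝ :=
  if Nontrivial G then sInf (pseudoExponentValues G) else 3

theorem isLeast_pseudoExponent (G : Type*) [Group G] [Finite G] [Nontrivial G] :
    IsLeast (pseudoExponentValues G) (pseudoExponent G) := by
  classical
  have : Fintype G := Fintype.ofFinite G
  rw [pseudoExponent, if_pos (inferInstanceAs (Nontrivial G))]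
  have hfin : (pseudoExponentValues G).Finite := by
    refine (Set.finite_range (fun s : Finset G × Finset G × Finset G =>
      3 * Real.log (Nat.card G) /
        Real.log ((s.1.card * s.2.1.card * s.2.2.card : ℕ) : ℝ))).subset ?_
    rintro x ⟨n, m, p, -, ⟨S₁, S₂, S₃, rfl, rfl, rfl, -⟩, rfl⟩
    exact ⟨(S₁, S₂, S₃), rfl⟩
  have hne : (pseudoExponentValues G).Nonempty := by
    refine ⟨_, 1, 1, Fintype.card G, ?_, ⟨{1}, {1}, Finset.univ, by simp, by simp, rfl, ?_⟩, rfl⟩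
    · simpa using Fintype.one_lt_card (α := G)
    · rintro q₁ ⟨a, ha, b, hb, rfl⟩ q₂ ⟨c, hc, d, hd, rfl⟩ q₃ - h
      simp only [Finset.coe_singleton, Set.mem_singleton_iff] at ha hb hc hd
      subst ha hb hc hd
      simpa using h
  exact ⟨hne.csInf_mem hfin, fun x hx => csInf_le hfin.bddBelow hx⟩

/-- The character degrees of `G`: the dimensions of its (finite-dimensional) irreducible complex
representations. -/
def characterDegrees (G : Type*) [Group G] : Set ℕ :=
  {d | ∃ (V : Type) (_ : AddCommGroup V) (_ : Module ℂ V) (ρ : Representation ℂ G V),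
    FiniteDimensional ℂ V ∧ ρ.IsIrreducible ∧ Module.finrank ℂ V = d}

/-- The largest character degree of a finite group. -/
def maxCharacterDegree (G : Type*) [Group G] : ℕ :=
  sSup (characterDegrees G)

open Classical in
/-- The parameter `γ(G)` of a finite group: `γ(G) = ∞` if `G` is abelian, and otherwise `γ(G)` is
the real number with `|G| ^ (1 / γ(G)) = d`, where `d > 1` is the largest character degree. -/
def gammaExponent (G : Type*) [Group G] : EReal :=
  if ∀ a b : G, a * b = b * a then ⊤
  else ((Real.log (Nat.card G) / Real.log (maxCharacterDegree G) : ℝ) : EReal)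

/-- The action of a permutation on vectors by permuting coordinates: `(π u)ᵢ = u_{π(i)}`. -/
def permuteCoords {A : Type*} {n : ℕ} (π : Equiv.Perm (Fin n)) (u : Fin n → A) : Fin n → A :=
  fun i => u (π i)

/-- The wreath product `A ≀ Sₙ`, i.e. the semidirect product `Sₙ ⋉ Aⁿ`, for a group `A` written
additively. -/
@[ext]
structure WreathProduct (A : Type*) (n : ℕ) where
  perm : Equiv.Perm (Fin n)
  vec : Fin n → A

namespace WreathProduct

variable {A : Type*} [AddGroup A] {n : ℕ}

/-- `(π, u) (π', v) = (π π', π' u + v)`. -/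
instance : Mul (WreathProduct A n) where
  mul g h := ⟨g.perm * h.perm, permuteCoords h.perm g.vec + h.vec⟩

instance : One (WreathProduct A n) where
  one := ⟨1, 0⟩

instance : Inv (WreathProduct A n) where
  inv g := ⟨g.perm⁻¹, permuteCoords g.perm⁻¹ (-g.vec)⟩

theorem mul_def (g h : WreathProduct A n) :
    g * h = ⟨g.perm * h.perm, permuteCoords h.perm g.vec + h.vec⟩ := rfl

theorem one_def : (1 : WreathProduct A n) = ⟨1, 0⟩ := rfl

theorem inv_def (g : WreathProduct A n) :
    g⁻¹ = ⟨g.perm⁻¹, permuteCoords g.perm⁻¹ (-g.vec)⟩ := rfl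

instance : Group (WreathProduct A n) :=
  Group.ofLeftAxioms
    (by
      intro a b c
      simp only [mul_def, WreathProduct.mk.injEq]
      refine ⟨mul_assoc _ _ _, ?_⟩
      funext i
      simp [permuteCoords, add_assoc])
    (by
      intro a
      simp only [mul_def, one_def]
      ext i <;> simp [permuteCoords])
    (by
      intro a
      simp only [mul_def, one_def, inv_def, WreathProduct.mk.injEq]
      refine ⟨inv_mul_cancel _, ?_⟩
      funext i
      simp [permuteCoords])

end WreathProduct

/-- The group `Gₙ = C_{2n} ≀ Sₙ`, for `n ≥ 1`. -/
abbrev wreathGroup (n : ℕ) : Type := WreathProduct (ZMod (2 * n)) n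

/-- The vector `u = (1, 2, …, n)` (the index `i : Fin n` runs from `0` to `n - 1`). -/
def ascendingVec (n : ℕ) : Fin n → ZMod (2 * n) := fun i => ((i : ℕ) : ZMod (2 * n)) + 1

/-- The vector `v = (n, n - 1, …, 1)`. -/
def descendingVec (n : ℕ) : Fin n → ZMod (2 * n) :=
  fun i => (n : ZMod (2 * n)) - ((i : ℕ) : ZMod (2 * n))

end

/-!
A subgroup of index `m` that is abelian bounds the degree of every irreducible representation by
`m`: an eigenvector of the subgroup is moved around by `m` cosets and spans the representation. For
the base group `Aⁿ` of `A ≀ Sₙ` this gives the bound `n!`. It is attained by the representation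
induced from a character of `Aⁿ` with `n` distinct components, whose `Sₙ`-conjugates are distinct
and so separate the coordinates of the induced representation.

The group realizes `⟨n!, n!, n!⟩`, so `α ≤ log |G| / log n! = γ`. Indeed, as `u + v` is constant,
an equation `h₁ h₂ h₃ = 1` between elements of the three subgroups says that every number is the
average of its images under two permutations `σ` and `τ`; modulo `2n` there is no wraparound.
Comparing the sums of squares of both sides forces `σ = τ = 1`.

For the asymptotics, write `log n! = n log n - n + r`. Stirling's formula gives `0 ≤ r ≤ n` and
`r log n ≤ n`, so the error term is at most a constant times `n / (log n! log n)`, and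
`log n! ≥ (n log n) / 2` because `n ^ n ≤ n! ^ 2`.
-/

/-! ### The triple product property -/

theorem rightQuotientSet_coe_subgroup {G : Type*} [Group G] (H : Subgroup G) :
    rightQuotientSet (H : Set G) = H := by
  ext q
  constructor
  · rintro ⟨a, ha, b, hb, rfl⟩
    exact H.mul_mem ha (H.inv_mem hb)
  · exact fun hq => ⟨q, hq, 1, H.one_mem, by simp⟩

theorem TripleProductProperty.realizes {G : Type*} [Group G] {S₁ S₂ S₃ : Set G}
    (h : TripleProductProperty S₁ S₂ S₃) (h₁ : S₁.Finite) (h₂ : S₂.Finite) (h₃ : S₃.Finite) :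
    Realizes G S₁.ncard S₂.ncard S₃.ncard :=
  ⟨h₁.toFinset, h₂.toFinset, h₃.toFinset, (Set.ncard_eq_toFinset_card _ h₁).symm,
    (Set.ncard_eq_toFinset_card _ h₂).symm, (Set.ncard_eq_toFinset_card _ h₃).symm, by simpa⟩

theorem Realizes.pseudoExponent_le {G : Type*} [Group G] [Finite G] {a b c : ℕ}
    (h : Realizes G a b c) (habc : 1 < a * b * c) :
    pseudoExponent G ≤ 3 * Real.log (Nat.card G) / Real.log ((a * b * c : ℕ) : ℝ) := by
  have : Nontrivial G := by
    by_contra hG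
    rw [not_nontrivial_iff_subsingleton] at hG
    obtain ⟨S₁, S₂, S₃, rfl, rfl, rfl, -⟩ := h
    have hle (S : Finset G) : S.card ≤ 1 := Finset.card_le_one_of_subsingleton S
    exact habc.not_ge (Nat.mul_le_mul (Nat.mul_le_mul (hle S₁) (hle S₂)) (hle S₃))
  exact (isLeast_pseudoExponent G).2 ⟨a, b, c, habc, h, rfl⟩

theorem Realizes.pseudoExponent_le_log_div_log {G : Type*} [Group G] [Finite G] {m : ℕ}
    (h : Realizes G m m m) (hm : 1 < m) :
    pseudoExponent G ≤ Real.log (Nat.card G) / Real.log m := by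
  have hm3 : m * m * m = m ^ 3 := by ring
  have hle := h.pseudoExponent_le (hm3 ▸ Nat.one_lt_pow three_ne_zero hm)
  rwa [hm3, Nat.cast_pow, Real.log_pow, Nat.cast_ofNat, mul_div_mul_left _ _ three_ne_zero] at hle

theorem gammaExponent_eq_of_isGreatest {G : Type*} [Group G] {d : ℕ}
    (hG : ¬ ∀ a b : G, a * b = b * a) (hd : IsGreatest (characterDegrees G) d) :
    gammaExponent G = ((Real.log (Nat.card G) / Real.log d : ℝ) : EReal) := by
  rw [gammaExponent, if_neg hG, maxCharacterDegree, hd.csSup_eq]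

theorem perm_eq_one_of_add_eq_two_mul {ι R : Type*} [Finite ι] [CommRing R] [LinearOrder R]
    [IsStrictOrderedRing R] {f : ι → R} (hf : Function.Injective f) {σ τ : Equiv.Perm ι}
    (h : ∀ i, f (σ i) + f (τ i) = 2 * f i) : σ = 1 ∧ τ = 1 := by
  have := Fintype.ofFinite ι
  have hsq (i) : (f (σ i) - f (τ i)) ^ 2 = 2 * f (σ i) ^ 2 + 2 * f (τ i) ^ 2 - 4 * f i ^ 2 := by
    linear_combination (-(f (σ i) + f (τ i)) - 2 * f i) * h i
  have hsum : ∑ i, (f (σ i) - f (τ i)) ^ 2 = 0 := by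
    simp only [hsq, Finset.sum_sub_distrib, Finset.sum_add_distrib, ← Finset.mul_sum,
      Equiv.sum_comp σ (fun i => f i ^ 2), Equiv.sum_comp τ (fun i => f i ^ 2)]
    ring
  have heq (i) : f (σ i) = f (τ i) :=
    sub_eq_zero.mp <| pow_eq_zero_iff two_ne_zero |>.mp <|
      (Finset.sum_eq_zero_iff_of_nonneg fun _ _ => sq_nonneg _).mp hsum i (Finset.mem_univ i)
  have hσ (i) : f (σ i) = f i := by linarith [h i, heq i]
  exact ⟨Equiv.ext fun i => hf (hσ i), Equiv.ext fun i => hf ((heq i).symm.trans (hσ i))⟩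

namespace WreathProduct

section Group

variable {A : Type*} [AddGroup A] {n : ℕ}

/-- The projection of the wreath product onto `Sₙ`; its kernel is the base group `Aⁿ`. -/
def permHom : WreathProduct A n →* Equiv.Perm (Fin n) where
  toFun := perm
  map_one' := rfl
  map_mul' _ _ := rfl

/-- The embedding `π ↦ (π, πu - u)` of `Sₙ` into the wreath product, which is the obvious embedding
`π ↦ (π, 0)` followed by conjugation by `(1, u)`. -/
def twistHom (u : Fin n → A) : Equiv.Perm (Fin n) →* WreathProduct A n :=
  MonoidHom.mk' (fun π => ⟨π, permuteCoords π u - u⟩) fun π σ =>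
    WreathProduct.ext rfl (funext fun i => by simp [mul_def, permuteCoords])

theorem twistHom_apply (u : Fin n → A) (π : Equiv.Perm (Fin n)) :
    twistHom u π = ⟨π, permuteCoords π u - u⟩ := rfl

theorem twistHom_injective (u : Fin n → A) : Function.Injective (twistHom u) :=
  fun _ _ h => congrArg perm h

theorem coe_range_twistHom (u : Fin n → A) :
    ((twistHom u).range : Set (WreathProduct A n)) =
      {g | ∃ π : Equiv.Perm (Fin n), g = ⟨π, permuteCoords π u - u⟩} :=
  Set.ext fun _ => exists_congr fun _ => eq_comm

theorem coe_range_twistHom_zero :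
    ((twistHom (0 : Fin n → A)).range : Set (WreathProduct A n)) =
      {g | ∃ π : Equiv.Perm (Fin n), g = ⟨π, 0⟩} := by
  have hzero (π : Equiv.Perm (Fin n)) : permuteCoords π (0 : Fin n → A) - 0 = 0 := sub_zero _
  simp only [coe_range_twistHom, hzero]

theorem ncard_range_twistHom (u : Fin n → A) :
    ((twistHom u).range : Set (WreathProduct A n)).ncard = n ! := by
  rw [MonoidHom.coe_range, Set.ncard_range_of_injective (twistHom_injective u),
    Nat.card_perm, Nat.card_fin]

theorem index_ker_permHom : (permHom (A := A) (n := n)).ker.index = n ! := by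
  have hsurj : Function.Surjective (permHom (A := A) (n := n)) := fun π => ⟨⟨π, 0⟩, rfl⟩
  rw [Subgroup.index_ker, MonoidHom.range_eq_top.mpr hsurj, Subgroup.card_top,
    Nat.card_perm, Nat.card_fin]

theorem not_forall_mul_comm [Nontrivial A] (hn : 2 ≤ n) :
    ¬ ∀ a b : WreathProduct A n, a * b = b * a := by
  intro hcomm
  obtain ⟨a, ha⟩ := exists_ne (0 : A)
  let i : Fin n := ⟨0, by omega⟩
  let j : Fin n := ⟨1, by omega⟩
  have hij : j ≠ i := by simp [i, j]
  have hj := congrFun (congrArg vec (hcomm ⟨1, Pi.single i a⟩ ⟨Equiv.swap i j, 0⟩)) j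
  exact ha (by simpa [mul_def, permuteCoords, hij] using hj)

end Group

section Card

variable (A : Type*) (n : ℕ)

/-- The underlying set of the wreath product is `Sₙ × Aⁿ`. -/
def equivProd : WreathProduct A n ≃ Equiv.Perm (Fin n) × (Fin n → A) where
  toFun g := (g.perm, g.vec)
  invFun p := ⟨p.1, p.2⟩

instance [Finite A] : Finite (WreathProduct A n) :=
  Finite.of_equiv _ (equivProd A n).symm

theorem natCard : Nat.card (WreathProduct A n) = n ! * Nat.card A ^ n := by
  rw [Nat.card_congr (equivProd A n), Nat.card_prod, Nat.card_fun, Nat.card_perm, Nat.card_fin]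

end Card

section CommGroup

variable {A : Type*} [AddCommGroup A] {n : ℕ}

instance : IsMulCommutative (permHom (A := A) (n := n)).ker :=
  ⟨⟨by
    rintro ⟨⟨π, x⟩, hπ⟩ ⟨⟨σ, y⟩, hσ⟩
    obtain rfl : π = 1 := hπ
    obtain rfl : σ = 1 := hσ
    exact Subtype.ext (WreathProduct.ext rfl (add_comm x y))⟩⟩

theorem mul_comm_of_subsingleton [Subsingleton (Fin n)] (a b : WreathProduct A n) :
    a * b = b * a := by
  have htriv (π : Equiv.Perm (Fin n)) (x : Fin n → A) : permuteCoords π x = x :=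
    funext fun i => congrArg x (Subsingleton.elim _ _)
  refine WreathProduct.ext (Subsingleton.elim _ _) ?_
  simp only [mul_def, htriv, add_comm]

theorem tripleProductProperty_twistHom {u v : Fin n → A} {s : A} (huv : ∀ i, u i + v i = s)
    (hu : ∀ σ τ : Equiv.Perm (Fin n),
      (∀ i, u (σ i) + u (τ i) = 2 • u i) → σ = 1 ∧ τ = 1) :
    TripleProductProperty ((twistHom (0 : Fin n → A)).range : Set (WreathProduct A n))
      (twistHom u).range (twistHom v).range := by
  intro q₁ h₁ q₂ h₂ q₃ h₃ h
  rw [rightQuotientSet_coe_subgroup] at h₁ h₂ h₃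
  obtain ⟨π₁, rfl⟩ := h₁
  obtain ⟨π₂, rfl⟩ := h₂
  obtain ⟨π₃, rfl⟩ := h₃
  have hperm : π₁ * π₂ * π₃ = 1 := congrArg perm h
  have hvec (i) : u (π₂ (π₃ i)) - u (π₃ i) + (v (π₃ i) - v i) = 0 := by
    simpa [mul_def, one_def, twistHom_apply, permuteCoords] using congrFun (congrArg vec h) i
  have haverage (i) : u (π₂ i) + u (π₃⁻¹ i) = 2 • u i := by
    have := hvec (π₃⁻¹ i)
    rw [show π₃ (π₃⁻¹ i) = i from π₃.apply_symm_apply i] at this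
    linear_combination (norm := module) this + huv (π₃⁻¹ i) - huv i
  obtain ⟨rfl, hπ₃⟩ := hu π₂ π₃⁻¹ haverage
  obtain rfl : π₃ = 1 := inv_eq_one.mp hπ₃
  obtain rfl : π₁ = 1 := by simpa using hperm
  simp only [map_one, and_self]

end CommGroup

end WreathProduct

theorem ascendingVec_add_descendingVec {n : ℕ} (i : Fin n) :
    ascendingVec n i + descendingVec n i = n + 1 := by
  rw [ascendingVec, descendingVec]
  ring

theorem perm_eq_one_of_ascendingVec_average {n : ℕ} (σ τ : Equiv.Perm (Fin n))
    (h : ∀ i, ascendingVec n (σ i) + ascendingVec n (τ i) = 2 • ascendingVec n i) :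
    σ = 1 ∧ τ = 1 := by
  refine perm_eq_one_of_add_eq_two_mul (f := fun i : Fin n => ((i : ℕ) : ℤ))
    (Nat.cast_injective.comp Fin.val_injective) fun i => ?_
  have hmod : ((σ i + τ i : ℕ) : ZMod (2 * n)) = (2 * i : ℕ) := by
    have := h i
    simp only [ascendingVec] at this
    push_cast
    linear_combination this
  -- There is no wraparound: both sides are at most `2n - 2`.
  rw [ZMod.natCast_eq_natCast_iff, Nat.ModEq, Nat.mod_eq_of_lt (by omega),
    Nat.mod_eq_of_lt (by omega)] at hmod
  exact_mod_cast hmod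

theorem tripleProductProperty_wreathGroup (n : ℕ) :
    TripleProductProperty
      ((WreathProduct.twistHom (0 : Fin n → ZMod (2 * n))).range : Set (wreathGroup n))
      (WreathProduct.twistHom (ascendingVec n)).range
      (WreathProduct.twistHom (descendingVec n)).range :=
  WreathProduct.tripleProductProperty_twistHom ascendingVec_add_descendingVec
    perm_eq_one_of_ascendingVec_average

theorem realizes_factorial_wreathGroup (n : ℕ) : Realizes (wreathGroup n) n ! n ! n ! := by
  have hfin (u : Fin n → ZMod (2 * n)) :
      ((WreathProduct.twistHom u).range : Set (wreathGroup n)).Finite := by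
    rw [MonoidHom.coe_range]
    exact Set.finite_range _
  simpa only [WreathProduct.ncard_range_twistHom] using
    (tripleProductProperty_wreathGroup n).realizes (hfin _) (hfin _) (hfin _)

/-! ### Irreducible representations -/

section Representation

variable {k : Type*} [Field k]

theorem exists_ne_zero_forall_apply_eq_smul [IsAlgClosed k] {H V : Type*} [CommMonoid H]
    [AddCommGroup V] [Module k V] [FiniteDimensional k V] [Nontrivial V]
    (ρ : Representation k H V) : ∃ v : V, v ≠ 0 ∧ ∀ h, ∃ c : k, ρ h v = c • v := by
  have : IsArtinian (MonoidAlgebra k H) ρ.asModule := isArtinian_of_tower k inferInstance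
  have : Nontrivial ρ.asModule := ‹Nontrivial V›
  obtain ⟨S, hS⟩ := IsAtomic.exists_atom (Submodule (MonoidAlgebra k H) ρ.asModule)
  have : IsSimpleModule (MonoidAlgebra k H) S := isSimpleModule_iff_isAtom.mpr hS
  have : FiniteDimensional k S :=
    FiniteDimensional.finiteDimensional_submodule (S.restrictScalars k)
  obtain ⟨v, hv0, hv⟩ := finrank_eq_one_iff'.mp
    (IsSimpleModule.finrank_eq_one_of_isMulCommutative (MonoidAlgebra k H) S k)
  refine ⟨ρ.asModuleEquiv v, by simpa using hv0, fun h => ?_⟩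
  obtain ⟨c, hc⟩ := hv (MonoidAlgebra.of k H h • v)
  have hc' : ρ.asModuleEquiv (MonoidAlgebra.of k H h • (v : ρ.asModule)) =
      ρ.asModuleEquiv (c • (v : ρ.asModule)) :=
    congrArg (fun w : S => ρ.asModuleEquiv w) hc.symm
  refine ⟨c, ?_⟩
  rwa [ρ.asModuleEquiv_map_smul, ρ.asAlgebraHom_of, map_smul] at hc'

open scoped IsMulCommutative in
theorem finrank_le_index_of_isMulCommutative [IsAlgClosed k] {G V : Type*} [Group G]
    [AddCommGroup V] [Module k V] [FiniteDimensional k V] {ρ : Representation k G V}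
    (hρ : ρ.IsIrreducible) (H : Subgroup G) [IsMulCommutative H] [H.FiniteIndex] :
    Module.finrank k V ≤ H.index := by
  have : Nontrivial V := by
    by_contra hV
    have := not_nontrivial_iff_subsingleton.mp hV
    exact not_subsingleton (Subrepresentation ρ)
      Subrepresentation.toSubmodule_injective.subsingleton
  obtain ⟨v, hv0, hv⟩ := exists_ne_zero_forall_apply_eq_smul (ρ.comp H.subtype)
  let W : Subrepresentation ρ :=
    ⟨Submodule.span k (Set.range fun g => ρ g v), fun g w hw => by
      rw [← Submodule.mem_comap]
      refine Submodule.span_le.mpr ?_ hw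
      rintro _ ⟨g', rfl⟩
      exact Submodule.subset_span ⟨g * g', by simp⟩⟩
  have hW : W.toSubmodule = ⊤ := by
    have hvW : v ∈ W.toSubmodule := Submodule.subset_span ⟨1, by simp⟩
    rcases hρ.eq_bot_or_eq_top W with h | h
    · rw [h] at hvW
      exact absurd hvW hv0
    · exact congrArg Subrepresentation.toSubmodule h
  have horbit : W.toSubmodule ≤ Submodule.span k (Set.range fun q : G ⧸ H => ρ q.out v) := by
    rw [Submodule.span_le]
    rintro _ ⟨g, rfl⟩
    obtain ⟨h, hgh⟩ := QuotientGroup.mk_out_eq_mul H g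
    obtain ⟨c, hc⟩ := hv h⁻¹
    have hgv : ρ g v = c • ρ (g : G ⧸ H).out v := by
      rw [← map_smul, ← hc, hgh, map_mul]
      simp [← Module.End.mul_apply, ← map_mul]
    exact Set.mem_of_eq_of_mem hgv (Submodule.smul_mem _ c (Submodule.subset_span ⟨g, rfl⟩))
  have := Fintype.ofFinite (G ⧸ H)
  calc Module.finrank k V = Module.finrank k (⊤ : Submodule k V) := (finrank_top k V).symm
    _ ≤ Module.finrank k (Submodule.span k (Set.range fun q : G ⧸ H => ρ q.out v)) :=
      Submodule.finrank_mono (hW ▸ horbit)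
    _ ≤ Fintype.card (G ⧸ H) := finrank_range_le_card _
    _ = H.index := by rw [Subgroup.index_eq_card, Nat.card_eq_fintype_card]

theorem single_one_mem_of_separating {ι X : Type*} [Finite ι] [DecidableEq ι]
    {W : Submodule k (ι → k)} {d : X → ι → k} (hW : ∀ x, ∀ f ∈ W, d x * f ∈ W)
    (hd : Function.Injective fun i x => d x i) {f : ι → k} (hf : f ∈ W) {i : ι} (hfi : f i ≠ 0) :
    Pi.single i 1 ∈ W := by
  have := Fintype.ofFinite ι
  have hvanish (s : Finset ι) (hs : i ∉ s) : ∃ g ∈ W, g i ≠ 0 ∧ ∀ j ∈ s, g j = 0 := by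
    induction s using Finset.induction_on with
    | empty => exact ⟨f, hf, hfi, by simp⟩
    | insert j s _ ih =>
      obtain ⟨hij, his⟩ : i ≠ j ∧ i ∉ s := by simpa using hs
      obtain ⟨g, hgW, hgi, hg⟩ := ih his
      obtain ⟨x, hx⟩ : ∃ x, d x i ≠ d x j := Function.ne_iff.mp (hd.ne hij)
      -- Multiplication by `d x - d x j` kills coordinate `j` and keeps coordinate `i` nonzero.
      refine ⟨d x * g - d x j • g, W.sub_mem (hW x g hgW) (W.smul_mem _ hgW), ?_, ?_⟩
      · simpa [← sub_mul, sub_eq_zero, hgi] using hx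
      · intro l hl
        rcases Finset.mem_insert.mp hl with rfl | hl
        · simp
        · simp [hg l hl]
  obtain ⟨g, hgW, hgi, hg⟩ := hvanish (Finset.univ.erase i) (Finset.notMem_erase i _)
  have hsingle : Pi.single i 1 = (g i)⁻¹ • g := by
    funext j
    by_cases hj : j = i
    · subst hj
      simp [hgi]
    · simp [hj, hg j (by simpa using hj)]
  exact hsingle ▸ W.smul_mem _ hgW

end Representation

namespace WreathProduct

variable {A : Type*} {n : ℕ}

/-- The representation of the wreath product induced from a character `χ` of the base group `Aⁿ`,
realized on functions on the permutations, which represent the cosets of `Aⁿ`. -/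
def inducedRep {k : Type*} [CommSemiring k] [AddGroup A] (χ : AddChar (Fin n → A) k) :
    Representation k (WreathProduct A n) (Equiv.Perm (Fin n) → k) where
  toFun g :=
    { toFun := fun f τ => χ (permuteCoords (g.perm⁻¹ * τ) g.vec) * f (g.perm⁻¹ * τ)
      map_add' := fun f f' => by ext τ; simp [mul_add]
      map_smul' := fun c f => by ext τ; simp [mul_left_comm] }
  map_one' := by
    ext f τ
    have hzero : permuteCoords τ (0 : Fin n → A) = 0 := rfl
    simp [one_def, hzero]
  map_mul' g h := by
    refine LinearMap.ext fun f => funext fun τ => ?_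
    have hvec : permuteCoords ((g * h).perm⁻¹ * τ) (g * h).vec =
        permuteCoords (g.perm⁻¹ * τ) g.vec + permuteCoords (h.perm⁻¹ * (g.perm⁻¹ * τ)) h.vec := by
      funext i
      simp [mul_def, permuteCoords]
    have hperm : (g * h).perm⁻¹ * τ = h.perm⁻¹ * (g.perm⁻¹ * τ) := by
      simp [mul_def, mul_assoc]
    change χ _ * f _ = χ _ * (χ _ * f _)
    rw [hvec, hperm, AddChar.map_add_eq_mul, mul_assoc]

theorem inducedRep_apply {k : Type*} [CommSemiring k] [AddGroup A] (χ : AddChar (Fin n → A) k)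
    (g : WreathProduct A n) (f : Equiv.Perm (Fin n) → k) (τ : Equiv.Perm (Fin n)) :
    inducedRep χ g f τ = χ (permuteCoords (g.perm⁻¹ * τ) g.vec) * f (g.perm⁻¹ * τ) := rfl

theorem inducedRep_perm_single {k : Type*} [CommSemiring k] [AddGroup A]
    (χ : AddChar (Fin n → A) k) (π σ : Equiv.Perm (Fin n)) :
    inducedRep χ ⟨π, 0⟩ (Pi.single σ 1) = Pi.single (π * σ) 1 := by
  funext τ
  have hzero (ρ : Equiv.Perm (Fin n)) : permuteCoords ρ (0 : Fin n → A) = 0 := rfl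
  simp [inducedRep_apply, hzero, Pi.single_apply, inv_mul_eq_iff_eq_mul]

theorem isIrreducible_inducedRep {k : Type*} [Field k] [AddGroup A] {χ : AddChar (Fin n → A) k}
    (hχ : Function.Injective fun (σ : Equiv.Perm (Fin n)) x => χ (permuteCoords σ x)) :
    (inducedRep χ).IsIrreducible where
  exists_pair_ne := ⟨⊥, ⊤, fun h => bot_ne_top (congrArg Subrepresentation.toSubmodule h)⟩
  eq_bot_or_eq_top W := by
    refine or_iff_not_imp_left.mpr fun hW => Subrepresentation.toSubmodule_injective ?_
    obtain ⟨f, hfW, hf0⟩ := Submodule.exists_mem_ne_zero_of_ne_bot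
      fun h => hW (Subrepresentation.toSubmodule_injective h)
    obtain ⟨σ, hσ⟩ := Function.ne_iff.mp hf0
    have hbase (x : Fin n → A) (f) (hf : f ∈ W.toSubmodule) :
        (fun τ => χ (permuteCoords τ x)) * f ∈ W.toSubmodule := by
      exact W.apply_mem_toSubmodule ⟨1, x⟩ hf
    have hσW : Pi.single σ 1 ∈ W.toSubmodule := single_one_mem_of_separating hbase hχ hfW hσ
    have hsingle (τ) : Pi.single τ 1 ∈ W.toSubmodule := by
      simpa [inducedRep_perm_single] using W.apply_mem_toSubmodule ⟨τ * σ⁻¹, 0⟩ hσW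
    refine Submodule.eq_top_iff'.mpr fun f => ?_
    rw [← (Pi.basisFun k (Equiv.Perm (Fin n))).sum_repr f]
    exact W.toSubmodule.sum_mem fun τ _ =>
      W.toSubmodule.smul_mem _ (by simpa only [Pi.basisFun_apply] using hsingle τ)

/-- The character `x ↦ ∏ᵢ ψᵢ(xᵢ)` of `Aⁿ` with components `ψᵢ`. -/
def prodChar {k : Type*} [CommMonoid k] [AddCommMonoid A] (ψ : Fin n → AddChar A k) :
    AddChar (Fin n → A) k :=
  ∏ i, (ψ i).compAddMonoidHom (Pi.evalAddMonoidHom _ i)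

theorem prodChar_apply {k : Type*} [CommMonoid k] [AddCommMonoid A] (ψ : Fin n → AddChar A k)
    (x : Fin n → A) : prodChar ψ x = ∏ i, ψ i (x i) :=
  AddChar.prod_apply ..

theorem prodChar_permuteCoords_injective {k : Type*} [CommMonoid k] [AddCommMonoid A]
    {ψ : Fin n → AddChar A k} (hψ : Function.Injective ψ) :
    Function.Injective fun (σ : Equiv.Perm (Fin n)) x => prodChar ψ (permuteCoords σ x) := by
  have hsingle (σ : Equiv.Perm (Fin n)) (j a) :
      prodChar ψ (permuteCoords σ (Pi.single j a)) = ψ (σ⁻¹ j) a := by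
    rw [prodChar_apply, Finset.prod_eq_single (σ⁻¹ j)]
    · simp [permuteCoords]
    · intro i _ hi
      have hij : σ i ≠ j := fun h => hi (by simp [← h])
      simp [permuteCoords, hij]
    · simp
  intro σ τ h
  refine inv_injective (Equiv.ext fun j => hψ (AddChar.ext _ _ fun a => ?_))
  rw [← hsingle, ← hsingle]
  exact congrFun h _

theorem finrank_le_factorial {k V : Type*} [Field k] [IsAlgClosed k] [AddCommGroup A]
    [AddCommGroup V] [Module k V] [FiniteDimensional k V]
    {ρ : Representation k (WreathProduct A n) V} (hρ : ρ.IsIrreducible) :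
    Module.finrank k V ≤ n ! := by
  have : (permHom (A := A) (n := n)).ker.FiniteIndex :=
    ⟨index_ker_permHom (A := A) ▸ n.factorial_ne_zero⟩
  exact index_ker_permHom (A := A) ▸ finrank_le_index_of_isMulCommutative hρ permHom.ker

theorem isGreatest_characterDegrees [AddCommGroup A] [Finite A] (hn : n ≤ Nat.card A) :
    IsGreatest (characterDegrees (WreathProduct A n)) n ! := by
  have := Fintype.ofFinite A
  constructor
  · obtain ⟨ψ⟩ : Nonempty (Fin n ↪ AddChar A ℂ) := Function.Embedding.nonempty_of_card_le <| by
      simpa [AddChar.card_eq] using hn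
    exact ⟨Equiv.Perm (Fin n) → ℂ, _, _, inducedRep (prodChar ψ), inferInstance,
      isIrreducible_inducedRep (prodChar_permuteCoords_injective ψ.injective),
      by simp [Fintype.card_perm]⟩
  · rintro d ⟨V, _, _, ρ, _, hρ, rfl⟩
    exact finrank_le_factorial hρ

end WreathProduct

/-! ### Asymptotics of `log n!` -/

theorem log_factorial_le_stirling (n : ℕ) :
    Real.log n ! ≤ n * Real.log n - n + Real.log n / 2 + 1 := by
  rcases n with _ | m
  · simp
  have h : Real.log (Stirling.stirlingSeq (m + 1)) ≤ Real.log (Stirling.stirlingSeq 1) :=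
    Stirling.log_stirlingSeq'_antitone (Nat.zero_le m)
  have hm : ((m + 1 : ℕ) : ℝ) ≠ 0 := by positivity
  rw [Stirling.stirlingSeq_one, Real.log_div (by positivity) (by positivity), Real.log_exp,
    Real.log_sqrt zero_le_two, Stirling.log_stirlingSeq_formula, Real.log_mul two_ne_zero hm,
    Real.log_div hm (by positivity), Real.log_exp] at h
  linarith

theorem exists_log_factorial_eq_mul_log_sub_add {n : ℕ} (hn : n ≠ 0) :
    ∃ r : ℝ, 0 ≤ r ∧ r ≤ n ∧ r * Real.log n ≤ n ∧ Real.log n ! = n * Real.log n - n + r := by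
  have hL : 0 ≤ Real.log n := Real.log_natCast_nonneg n
  have hπ : 0 < Real.log (2 * Real.pi) := Real.log_pos (by linarith [Real.pi_gt_three])
  have hlower := Stirling.le_log_factorial_stirling hn
  have hupper := log_factorial_le_stirling n
  have hpow : Real.log n ! ≤ n * Real.log n := by
    rw [← Real.log_pow]
    exact Real.log_le_log (by positivity) (by exact_mod_cast n.factorial_le_pow)
  have hquad := Real.quadratic_le_exp_of_nonneg hL
  rw [Real.exp_log (by positivity)] at hquad
  refine ⟨Real.log n ! - (n * Real.log n - n), by linarith, by linarith, ?_, by ring⟩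
  calc (Real.log n ! - (n * Real.log n - n)) * Real.log n
      ≤ (Real.log n / 2 + 1) * Real.log n := by gcongr; linarith
    _ ≤ n := by linarith

theorem pow_self_le_factorial_sq (n : ℕ) : n ^ n ≤ n ! ^ 2 := by
  have hterm (i) (hi : i ∈ Finset.range n) : n ≤ (i + 1) * (n - 1 - i + 1) := by
    obtain ⟨j, rfl⟩ := Nat.exists_eq_add_of_lt (Finset.mem_range.mp hi)
    have hj : i + j + 1 - 1 - i = j := by omega
    rw [hj]
    nlinarith [Nat.zero_le (i * j)]
  calc n ^ n = ∏ _i ∈ Finset.range n, n := by simp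
    _ ≤ ∏ i ∈ Finset.range n, (i + 1) * (n - 1 - i + 1) := Finset.prod_le_prod' hterm
    _ = n ! ^ 2 := by
      rw [Finset.prod_mul_distrib, Finset.prod_range_reflect (fun i => i + 1),
        Finset.prod_range_add_one_eq_factorial, sq]

theorem mul_log_div_two_le_log_factorial (n : ℕ) : n * Real.log n / 2 ≤ Real.log n ! := by
  rcases n.eq_zero_or_pos with rfl | hn
  · simp
  have h : ((n : ℝ)) ^ n ≤ (n ! : ℝ) ^ 2 := by exact_mod_cast pow_self_le_factorial_sq n
  have hlog := Real.log_le_log (by positivity) h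
  rw [Real.log_pow, Real.log_pow, Nat.cast_ofNat] at hlog
  linarith

theorem abs_log_div_log_factorial_sub_le {n : ℕ} (hn : 2 ≤ n) {c : ℝ} (hc : 0 ≤ c) :
    |(Real.log n ! + n * (c + Real.log n)) / Real.log n ! - (2 + (1 + c) / Real.log n)| ≤
      2 * (1 + c) / Real.log n ^ 2 := by
  have hn0 : (0 : ℝ) < n := by positivity
  have hL : 0 < Real.log n := Real.log_pos (by exact_mod_cast hn)
  obtain ⟨r, hr0, hrn, hrL, hr⟩ := exists_log_factorial_eq_mul_log_sub_add (n := n) (by omega)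
  have hmain := mul_log_div_two_le_log_factorial n
  generalize Real.log n = L at *
  generalize Real.log n ! = M at *
  have hM : 0 < M := by linarith [mul_pos hn0 hL]
  have hdiff : (M + n * (c + L)) / M - (2 + (1 + c) / L) =
      ((1 + c) * (n - r) - r * L) / (M * L) := by
    field_simp
    rw [hr]
    ring
  have hnum : |(1 + c) * (n - r) - r * L| ≤ (1 + c) * n := by
    have hrL0 : 0 ≤ r * L := mul_nonneg hr0 hL.le
    have hcr : 0 ≤ (1 + c) * r := by positivity
    have hcrn : 0 ≤ (1 + c) * (n - r) := mul_nonneg (by positivity) (sub_nonneg.mpr hrn)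
    have hcn : 0 ≤ c * n := by positivity
    exact abs_le.mpr ⟨by linarith, by linarith⟩
  rw [hdiff, abs_div, abs_of_pos (mul_pos hM hL)]
  calc |(1 + c) * (n - r) - r * L| / (M * L) ≤ (1 + c) * n / (n * L / 2 * L) := by gcongr
    _ = 2 * (1 + c) / L ^ 2 := by field_simp

/-! ### The groups `Gₙ` -/

theorem isGreatest_characterDegrees_wreathGroup {n : ℕ} (hn : n ≠ 0) :
    IsGreatest (characterDegrees (wreathGroup n)) n ! := by
  have : NeZero (2 * n) := ⟨by omega⟩
  exact WreathProduct.isGreatest_characterDegrees (by rw [Nat.card_zmod]; omega)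

theorem gammaExponent_wreathGroup {n : ℕ} (hn : 2 ≤ n) :
    gammaExponent (wreathGroup n) =
      ((Real.log (Nat.card (wreathGroup n)) / Real.log n ! : ℝ) : EReal) := by
  have : Fact (1 < 2 * n) := ⟨by omega⟩
  exact gammaExponent_eq_of_isGreatest (WreathProduct.not_forall_mul_comm hn)
    (isGreatest_characterDegrees_wreathGroup (by omega))

theorem log_card_wreathGroup {n : ℕ} (hn : n ≠ 0) :
    Real.log (Nat.card (wreathGroup n)) =
      Real.log n ! + n * (Real.log 2 + Real.log n) := by
  rw [WreathProduct.natCard, Nat.card_zmod]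
  push_cast
  rw [Real.log_mul (by positivity) (by positivity), Real.log_pow,
    Real.log_mul two_ne_zero (by positivity)]

theorem pseudoExponent_wreathGroup_le_gammaExponent {n : ℕ} (hn : n ≠ 0) :
    (pseudoExponent (wreathGroup n) : EReal) ≤ gammaExponent (wreathGroup n) := by
  have : NeZero (2 * n) := ⟨by omega⟩
  rcases (Nat.one_le_iff_ne_zero.mpr hn).eq_or_lt with rfl | hn
  · rw [gammaExponent, if_pos WreathProduct.mul_comm_of_subsingleton]
    exact le_top
  · rw [gammaExponent_wreathGroup hn, EReal.coe_le_coe_iff]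
    exact (realizes_factorial_wreathGroup n).pseudoExponent_le_log_div_log
      (Nat.one_lt_factorial.mpr hn)

theorem mainTheorem6 :
    (∀ n : ℕ, 1 ≤ n →
      (∃ H₁ H₂ H₃ : Subgroup (wreathGroup n),
        (H₁ : Set (wreathGroup n)) = {g | ∃ π : Equiv.Perm (Fin n), g = ⟨π, 0⟩} ∧
        (H₂ : Set (wreathGroup n)) = {g | ∃ π : Equiv.Perm (Fin n),
          g = ⟨π, permuteCoords π (ascendingVec n) - ascendingVec n⟩} ∧
        (H₃ : Set (wreathGroup n)) = {g | ∃ π : Equiv.Perm (Fin n),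
          g = ⟨π, permuteCoords π (descendingVec n) - descendingVec n⟩} ∧
        TripleProductProperty (H₁ : Set (wreathGroup n)) (H₂ : Set (wreathGroup n))
          (H₃ : Set (wreathGroup n))) ∧
      IsGreatest (characterDegrees (wreathGroup n)) n ! ∧
      ((pseudoExponent (wreathGroup n) : ℝ) : EReal) ≤ gammaExponent (wreathGroup n)) ∧
    (∃ C : ℝ, ∀ n : ℕ, 2 ≤ n → ∃ γ : ℝ,
      gammaExponent (wreathGroup n) = (γ : EReal) ∧
      |γ - (2 + (1 + Real.log 2) / Real.log n)| ≤ C / (Real.log n) ^ 2) := by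
  constructor
  · intro n hn
    have hn0 : n ≠ 0 := Nat.one_le_iff_ne_zero.mp hn
    exact ⟨⟨_, _, _, WreathProduct.coe_range_twistHom_zero, WreathProduct.coe_range_twistHom _,
      WreathProduct.coe_range_twistHom _, tripleProductProperty_wreathGroup n⟩,
      isGreatest_characterDegrees_wreathGroup hn0,
      pseudoExponent_wreathGroup_le_gammaExponent hn0⟩
  · refine ⟨2 * (1 + Real.log 2), fun n hn => ⟨_, gammaExponent_wreathGroup hn, ?_⟩⟩
    rw [log_card_wreathGroup (by omega)]
    exact abs_log_div_log_factorial_sub_le hn (Real.log_nonneg one_le_two)
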